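/- Let $T,D,a\in\mathbb{R}$ with $a^2+D^2\neq 0$ and consider the planar linear system in generalized Liénard form $$\dot x = Tx-y,\qquad \dot y = Dx-a .$$ For $y_0\ge 0$ let $\Phi(t;y_0)=(\Phi_1(t;y_0),\Phi_2(t;y_0))$ be its solution with $\Phi(0;y_0)=(0,y_0)$. The left Poincaré half-map $P:I\subset[0,\infty)\to(-\infty,0]$ associated to the section $\{x=0\}$ is defined at $y_0\ge 0$ by $P(y_0)=\Phi_2(\tau;y_0)$ whenever there is $\tau>0$ such that $\Phi_1(\tau;y_0)=0$ and $\Phi_1(t;y_0)<0$ for all $t\in(0,\tau)$; moreover, if there is no such $\tau$ for $y_0=0$, then $P(0)=0$ provided that for every $\varepsilon>0$ there are $y_0\in(0,\varepsilon)$ and $y_1\in(-\varepsilon,0)$ with $P(y_0)=y_1$. The domain $I$ is the set of all $y_0\ge0$ at which $P$ is defined in this way (possibly $I=\emptyset$). Then: 1. If $T=0$, the graph $\{(y_0,P(y_0)) : y_0\in I\}$ is contained in the bisector $\{(y_0,y_1): y_0\ge 0,\ y_1=-y_0\}$ of the fourth quadrant. 2. If $T>0$ (resp. $T<0$), then every point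 $(y_0,P(y_0))$ of the graph other than the origin $(0,0)$ lies strictly below (resp. strictly above) that bisector, i.e. $P(y_0)<-y_0$ (resp. $P(y_0)>-y_0$). -/

import Mathlib

namespace Lienard

/-- `(x, y)` is a (global) solution of the planar linear system in generalized Liénard form
`x' = T x - y`, `y' = D x - a`. -/
def IsSolution (T D a : ℝ) (x y : ℝ → ℝ) : Prop :=
  ∀ t : ℝ, HasDerivAt x (T * x t - y t) t ∧ HasDerivAt y (D * x t - a) t

/-- The solution starting at the point `(0, y₀)` of the section `x = 0` enters the half-plane `x < 0`,
stays there during the time interval `(0, τ)` and is back on the section,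
at the point `(0, y₁)`, at time `τ > 0` (the left flight time). -/
def IsLeftReturn (T D a y₀ y₁ τ : ℝ) : Prop :=
  0 < τ ∧ ∃ x y : ℝ → ℝ, IsSolution T D a x y ∧ x 0 = 0 ∧ y 0 = y₀ ∧
    (∀ t ∈ Set.Ioo 0 τ, x t < 0) ∧ x τ = 0 ∧ y τ = y₁

/-- `P(y₀) = y₁` for the left Poincaré half-map `P`: either `y₀ ≥ 0` and the orbit of `(0, y₀)` returns
through `x < 0` to the section at `(0, y₁)`, or `y₀ = y₁ = 0`, the orbit of the origin has
no such return, and `P` extends continuously to the origin by `P(0) = 0`, because there are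
arbitrarily small `u > 0` with arbitrarily small `P(u) < 0`. -/
def IsLeftHalfMapValue (T D a y₀ y₁ : ℝ) : Prop :=
  (0 ≤ y₀ ∧ ∃ τ, IsLeftReturn T D a y₀ y₁ τ) ∨
  (y₀ = 0 ∧ y₁ = 0 ∧ (¬ ∃ v τ, IsLeftReturn T D a 0 v τ) ∧
    ∀ ε > 0, ∃ u ∈ Set.Ioo 0 ε, ∃ v ∈ Set.Ioo (-ε) 0, ∃ τ, IsLeftReturn T D a u v τ)

theorem IsSolution.unique {T D a : ℝ} {x y x' y' : ℝ → ℝ} (h : IsSolution T D a x y)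
    (h' : IsSolution T D a x' y') (hx : x 0 = x' 0) (hy : y 0 = y' 0) : x = x' ∧ y = y' := by
  let L : ℝ × ℝ →L[ℝ] ℝ × ℝ :=
    (T • ContinuousLinearMap.fst ℝ ℝ ℝ - ContinuousLinearMap.snd ℝ ℝ ℝ).prod
      (D • ContinuousLinearMap.fst ℝ ℝ ℝ)
  have key : (fun t => (x t - x' t, y t - y' t)) = fun _ => (0, 0) := by
    refine ODE_solution_unique_univ (v := fun _ p => L p) (s := fun _ => Set.univ)
      (K := ‖L‖₊) (t₀ := 0) (fun _ => L.lipschitz.lipschitzOnWith)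
      (fun t => ⟨?_, trivial⟩) (fun t => ⟨?_, trivial⟩) ?_
    · refine (((h t).1.sub (h' t).1).prodMk ((h t).2.sub (h' t).2)).congr_deriv ?_
      change (_, _) = (T * (x t - x' t) - (y t - y' t), D * (x t - x' t))
      simp only [Prod.mk.injEq]
      constructor <;> ring
    · exact (hasDerivAt_const t ((0 : ℝ), (0 : ℝ))).congr_deriv (map_zero L).symm
    · simp [hx, hy]
  constructor
  · funext t
    exact sub_eq_zero.mp (congrArg Prod.fst (congrFun key t))
  · funext t
    exact sub_eq_zero.mp (congrArg Prod.snd (congrFun key t))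

/-- The value of the left Poincaré half-map at a point is unique. -/
theorem IsLeftHalfMapValue.unique {T D a y₀ y₁ y₂ : ℝ} (h₁ : IsLeftHalfMapValue T D a y₀ y₁)
    (h₂ : IsLeftHalfMapValue T D a y₀ y₂) : y₁ = y₂ := by
  rcases h₁ with ⟨_, τ, hr⟩ | ⟨h0, h1, hn, _⟩
  · rcases h₂ with ⟨_, σ, hs⟩ | ⟨h0, _, hn, _⟩
    · obtain ⟨hτ, x, y, hsol, hx0, hy0, hneg, hxτ, hyτ⟩ := hr
      obtain ⟨hσ, x', y', hsol', hx0', hy0', hneg', hxσ, hyσ⟩ := hs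
      obtain ⟨rfl, rfl⟩ := hsol.unique hsol' (hx0.trans hx0'.symm) (hy0.trans hy0'.symm)
      rcases lt_trichotomy τ σ with hlt | rfl | hlt
      · exact absurd hxτ (hneg' τ ⟨hτ, hlt⟩).ne
      · exact hyτ.symm.trans hyσ
      · exact absurd hxσ (hneg σ ⟨hσ, hlt⟩).ne
    · subst h0
      exact absurd ⟨_, _, hr⟩ hn
  · rcases h₂ with ⟨_, σ, hs⟩ | ⟨_, h2, _, _⟩
    · subst h0
      exact absurd ⟨_, _, hs⟩ hn
    · rw [h1, h2]

/-- The left Poincaré half-map `P : I ⊆ [0, ∞) → (-∞, 0]` associated to the section `x = 0`, as a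
partial function: its domain `I` is the set of those `y₀` that have an image. -/
noncomputable def leftHalfMap (T D a : ℝ) : ℝ →. ℝ :=
  fun y₀ => ⟨∃ y₁, IsLeftHalfMapValue T D a y₀ y₁, fun h => h.choose⟩

theorem mem_leftHalfMap_iff {T D a y₀ y₁ : ℝ} :
    y₁ ∈ leftHalfMap T D a y₀ ↔ IsLeftHalfMapValue T D a y₀ y₁ := by
  constructor
  · rintro ⟨h, rfl⟩
    exact Exists.choose_spec h
  · intro h
    have hd : ∃ y₁, IsLeftHalfMapValue T D a y₀ y₁ := ⟨y₁, h⟩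
    exact ⟨hd, hd.choose_spec.unique h⟩

/-- The bisector `y₁ = -y₀` of the (closed) fourth quadrant of the `(y₀, y₁)`-plane. -/
def fourthQuadrantBisector : Set (ℝ × ℝ) :=
  {p | 0 ≤ p.1 ∧ p.2 = -p.1}

end Lienard

namespace Lienard

/-! Since `x'' = T x' - D x + a`, the energy has derivative `T x'²`, and on `x = 0` it equals `y² /
2`. Hence `y₁² - y₀²` is zero for `T = 0` and otherwise has the sign of `T`, strictly because `x` is
not constant. As `y₁ ≤ 0 ≤ y₀`, comparing squares compares `-y₁` with `y₀`. -/

/-- The energy `((x')² + D x²) / 2 - a x` of a solution, written in terms of `(x, y)`. -/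
noncomputable def energy (T D a : ℝ) (x y : ℝ → ℝ) (t : ℝ) : ℝ :=
  ((T * x t - y t) ^ 2 + D * x t ^ 2) / 2 - a * x t

theorem IsSolution.hasDerivAt_energy {T D a : ℝ} {x y : ℝ → ℝ} (h : IsSolution T D a x y) (t : ℝ) :
    HasDerivAt (energy T D a x y) (T * (T * x t - y t) ^ 2) t := by
  obtain ⟨hx, hy⟩ := h t
  refine (((((hx.const_mul T).sub hy).pow 2).add ((hx.pow 2).const_mul D)).div_const 2 |>.sub
    (hx.const_mul a)).congr_deriv ?_
  simp only [Pi.sub_apply, Nat.cast_ofNat, Nat.add_one_sub_one, pow_one]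
  ring

/-- An orbit reaches the section from the half-plane `x < 0` only at a point with `y ≤ 0`. -/
theorem IsLeftReturn.nonpos {T D a y₀ y₁ τ : ℝ} (h : IsLeftReturn T D a y₀ y₁ τ) : y₁ ≤ 0 := by
  obtain ⟨hτ, x, y, hsol, -, -, hneg, hxτ, rfl⟩ := h
  have hd := (hsol τ).1.hasDerivWithinAt (s := Set.Iio τ)
  rw [hasDerivWithinAt_iff_tendsto_slope' (by simp), hxτ] at hd
  have : 0 ≤ T * 0 - y τ := by
    refine ge_of_tendsto hd ?_
    filter_upwards [Ioo_mem_nhdsLT hτ] with t ht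
    rw [slope_def_field, hxτ, sub_zero]
    exact div_nonneg_of_nonpos (hneg t ht).le (sub_nonpos.mpr ht.2.le)
  linarith

theorem IsLeftReturn.sq_eq_of_trace_eq_zero {D a y₀ y₁ τ : ℝ} (h : IsLeftReturn 0 D a y₀ y₁ τ) :
    y₁ ^ 2 = y₀ ^ 2 := by
  obtain ⟨-, x, y, hsol, hx0, rfl, -, hxτ, rfl⟩ := h
  have hE := is_const_of_deriv_eq_zero (f := energy 0 D a x y)
    (fun t => (hsol.hasDerivAt_energy t).differentiableAt)
    (fun t => by rw [(hsol.hasDerivAt_energy t).deriv, zero_mul]) τ 0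
  simp only [energy, hx0, hxτ] at hE
  linarith

/-- The factor `T` treats both signs at once: `T * energy` has derivative `(T x')² ≥ 0`. -/
theorem IsLeftReturn.trace_mul_sq_lt {T D a y₀ y₁ τ : ℝ} (hT : T ≠ 0)
    (h : IsLeftReturn T D a y₀ y₁ τ) : T * y₀ ^ 2 < T * y₁ ^ 2 := by
  obtain ⟨hτ, x, y, hsol, hx0, rfl, hneg, hxτ, rfl⟩ := h
  have hF (t : ℝ) : HasDerivAt (fun s => T * energy T D a x y s) ((T * (T * x t - y t)) ^ 2) t :=
    ((hsol.hasDerivAt_energy t).const_mul T).congr_deriv (by ring)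
  have hmono : Monotone fun s => T * energy T D a x y s :=
    monotone_of_hasDerivAt_nonneg hF fun t => sq_nonneg _
  -- The mean value theorem on `[0, τ/2]`, where `x` drops from `0` to a negative value, gives a
  -- time `c` with `x' ≠ 0`.
  obtain ⟨c, hc, hcx⟩ := exists_hasDerivAt_eq_slope x (fun t => T * x t - y t) (half_pos hτ)
    (fun t _ => (hsol t).1.continuousAt.continuousWithinAt) fun t _ => (hsol t).1
  have hw : T * x c - y c ≠ 0 := by
    rw [hcx, hx0, sub_zero, sub_zero]
    exact (div_neg_of_neg_of_pos (hneg _ ⟨half_pos hτ, half_lt_self hτ⟩) (half_pos hτ)).ne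
  have hlt : T * energy T D a x y 0 < T * energy T D a x y τ := by
    -- Equal end values would make the monotone function constant near `c`, so its derivative there
    -- would vanish.
    refine lt_of_le_of_ne (hmono hτ.le) fun heq => ?_
    have hconst : (fun s => T * energy T D a x y s) =ᶠ[nhds c]
        fun _ => T * energy T D a x y 0 := by
      filter_upwards [Ioo_mem_nhds hc.1 (hc.2.trans (half_lt_self hτ))] with s hs
      exact le_antisymm ((hmono hs.2.le).trans heq.ge) (hmono hs.1.le)
    have h0 := (hF c).unique ((hasDerivAt_const c _).congr_of_eventuallyEq hconst)
    exact pow_ne_zero 2 (mul_ne_zero hT hw) h0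
  simp only [energy, hx0, hxτ] at hlt
  linarith

end Lienard

theorem corollary6 (T D a : ℝ) (had : a ^ 2 + D ^ 2 ≠ 0) :
    (T = 0 → (Lienard.leftHalfMap T D a).graph ⊆ Lienard.fourthQuadrantBisector) ∧
    (0 < T → ∀ p ∈ (Lienard.leftHalfMap T D a).graph, p ≠ (0, 0) → p.2 < -p.1) ∧
    (T < 0 → ∀ p ∈ (Lienard.leftHalfMap T D a).graph, p ≠ (0, 0) → -p.1 < p.2) := by
  refine ⟨?_, ?_, ?_⟩
  · rintro rfl ⟨y₀, y₁⟩ hp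
    rcases Lienard.mem_leftHalfMap_iff.mp hp with ⟨h0, τ, h⟩ | ⟨rfl, rfl, -⟩
    · have h1 := h.nonpos
      exact ⟨h0, (eq_or_eq_neg_of_sq_eq_sq _ _ h.sq_eq_of_trace_eq_zero).elim
        -- If `y₁ = y₀`, the signs force both to be `0`.
        (fun e => by dsimp only at *; linarith) id⟩
    · simp [Lienard.fourthQuadrantBisector]
  · rintro hT ⟨y₀, y₁⟩ hp hne
    rcases Lienard.mem_leftHalfMap_iff.mp hp with ⟨h0, τ, h⟩ | ⟨rfl, rfl, -⟩
    · have h1 := h.nonpos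
      have hsq := lt_of_mul_lt_mul_left (h.trace_mul_sq_lt hT.ne') hT.le
      dsimp only at *
      nlinarith
    · exact absurd rfl hne
  · rintro hT ⟨y₀, y₁⟩ hp hne
    rcases Lienard.mem_leftHalfMap_iff.mp hp with ⟨h0, τ, h⟩ | ⟨rfl, rfl, -⟩
    · have h1 := h.nonpos
      have hsq := lt_of_mul_lt_mul_of_nonpos_left (h.trace_mul_sq_lt hT.ne) hT.le
      dsimp only at *
      nlinarith
    · exact absurd rfl hne
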